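/- Definitions. For an integer $m\ge 0$ and $a<b$, let $C^m_{\rm cl}(a,b)$ be the set of $f\in C^m(a,b)$ such that every derivative $f^{(k)}$, $0\le k\le m$, has finite one-sided limits at $a$ and at $b$. Let $C^m_{\rm cl}((-1,1)\setminus\{0\})$ be the set of functions $f:(-1,1)\to\mathbb R$ whose restrictions to $(-1,0)$ and to $(0,1)$ lie in $C^m_{\rm cl}(-1,0)$ and $C^m_{\rm cl}(0,1)$, respectively (the value $f(0)$ is arbitrary). A Fourier ResNet of depth $d\ge 2$ is a function $F=f_d:\mathbb R\to\mathbb R$ defined recursively by $$f_1(x)=\Re\sum_{k=1}^{p_1}c_{1,k}e^{i\omega_{1,k}x},\qquad f_\ell(x)=f_{\ell-1}(x)+\Re\sum_{k=1}^{p_\ell}c_{\ell,k}e^{i\omega_{\ell,k}x}+\Re\sum_{k=1}^{q_\ell}c'_{\ell,k}e^{i\omega'_{\ell,k}f_{\ell-1}(x)},\quad 2\le\ell\le d,$$ with frequencies $\omega_{\ell,k},\omega'_{\ell,k}\in\mathbb R$ and coefficients $c_{\ell,k},c'_{\ell,k}\in\mathbb C$. The width of layer $\ell$ is its total number of neurons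 $p_\ell+q_\ell$ (with $q_1=0$); layers $1,\dots,d-1$ are the hidden layers and layer $d$ is the final layer. Theorem. Let $m\ge 1$ be an integer. For all integers $L,W\ge 1$ there are layer sizes $p_\ell,q_\ell$ and real frequencies $\omega_{\ell,k},\omega'_{\ell,k}$ for a Fourier ResNet of depth $L+1$, depending only on $m$, $L$ and $W$, with all hidden layers of width at most $2$ and the final layer of width $W+4(m+1)$, such that the following holds. For every $f\in C^m_{\rm cl}((-1,1)\setminus\{0\})$ there are constants $C_m,D_m>0$, depending on $f$ and $m$ but not on $L$ or $W$, such that for all integers $L,W\ge 1$ there are coefficients $c_{\ell,k},c'_{\ell,k}\in\mathbb C$ with $|c_{\ell,k}|\le D_m$ and $|c'_{\ell,k}|\le D_m$ for all $\ell,k$, for which the Fourier ResNet $F$ with these frequencies and coefficients satisfies $$\|f-F\|_{L^2(-1,1)}\le C_m\left(2^{-L/2}+W^{-m+1/2}\right).$$ -/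

import Mathlib

open Filter Topology MeasureTheory

/-- `f ∈ C^m_cl(a, b)`: `f` is `m` times continuously differentiable on the open interval `(a, b)`
and every derivative `f^(k)`, `0 ≤ k ≤ m`, has a finite limit as `x → a⁺` and as `x → b⁻`.
Only the values of `f` on `(a, b)` matter. -/
def IsCmCl (m : ℕ) (a b : ℝ) (f : ℝ → ℝ) : Prop :=
  ContDiffOn ℝ m f (Set.Ioo a b) ∧
    ∀ k ≤ m,
      (∃ α : ℝ, Tendsto (iteratedDeriv k f) (𝓝[>] a) (𝓝 α)) ∧
      (∃ β : ℝ, Tendsto (iteratedDeriv k f) (𝓝[<] b) (𝓝 β))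

/-- `f ∈ C^m_cl((-1, 1) \ {0})`: `f` belongs to `C^m_cl(-1, 0)` and to `C^m_cl(0, 1)`.
The value `f 0` is arbitrary. -/
def IsPiecewiseCmCl (m : ℕ) (f : ℝ → ℝ) : Prop :=
  IsCmCl m (-1) 0 f ∧ IsCmCl m 0 1 f

/-- The real-valued trigonometric sum `y ↦ Re ∑ₖ cₖ e^{i ωₖ y}` computed by `n` neurons with
amplitudes `c` and frequencies `ω`. -/
noncomputable def fourierBranch {n : ℕ} (c : Fin n → ℂ) (ω : Fin n → ℝ) (y : ℝ) : ℝ :=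
  (∑ k : Fin n, c k * Complex.exp (Complex.I * (ω k : ℂ) * (y : ℂ))).re

/-- Neuron counts and frequencies of a Fourier residual network of depth `L + 1`, that is with
`L` hidden layers and one final layer. Layers are indexed from `0` (first layer) to `L` (final
layer). The upper branch of a layer acts on the input `x` of the network, the lower branch acts on
the output of the previous layer; the first layer has no lower branch. -/
structure FourierFrequencies (L : ℕ) where
  /-- number of neurons in the upper branch -/
  upperWidth : Fin (L + 1) → ℕ
  /-- number of neurons in the lower branch -/
  lowerWidth : Fin (L + 1) → ℕ
  lowerWidth_first : lowerWidth 0 = 0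
  /-- the frequencies `ω_{ℓ,k}` of the upper branches -/
  upper : ∀ ℓ, Fin (upperWidth ℓ) → ℝ
  /-- the frequencies `ω'_{ℓ,k}` of the lower branches -/
  lower : ∀ ℓ, Fin (lowerWidth ℓ) → ℝ

/-- The width of a layer: the total number of neurons in its two branches. -/
def FourierFrequencies.width {L : ℕ} (Ω : FourierFrequencies L) (ℓ : Fin (L + 1)) : ℕ :=
  Ω.upperWidth ℓ + Ω.lowerWidth ℓ

/-- The complex amplitudes of a Fourier residual network with given frequencies. Together with
`Ω` they determine the network. -/
structure FourierAmplitudes {L : ℕ} (Ω : FourierFrequencies L) where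
  /-- the amplitudes `c_{ℓ,k}` of the upper branches -/
  upper : ∀ ℓ, Fin (Ω.upperWidth ℓ) → ℂ
  /-- the amplitudes `c'_{ℓ,k}` of the lower branches -/
  lower : ∀ ℓ, Fin (Ω.lowerWidth ℓ) → ℂ

namespace FourierAmplitudes

variable {L : ℕ} {Ω : FourierFrequencies L}

/-- The output of layer `ℓ`: the first layer returns its upper branch `g(x)`, and each later layer
returns `y + g_ℓ(x) + h_ℓ(y)`, where `y` is the output of the previous layer. -/
noncomputable def layerOutput (c : FourierAmplitudes Ω) : (ℓ : ℕ) → ℓ < L + 1 → ℝ → ℝ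
  | 0, h, x => fourierBranch (c.upper ⟨0, h⟩) (Ω.upper ⟨0, h⟩) x
  | ℓ + 1, h, x =>
      layerOutput c ℓ (Nat.lt_of_succ_lt h) x
        + fourierBranch (c.upper ⟨ℓ + 1, h⟩) (Ω.upper ⟨ℓ + 1, h⟩) x
        + fourierBranch (c.lower ⟨ℓ + 1, h⟩) (Ω.lower ⟨ℓ + 1, h⟩)
            (layerOutput c ℓ (Nat.lt_of_succ_lt h) x)

/-- The function computed by the network: the output of its final layer. -/
noncomputable def realize (c : FourierAmplitudes Ω) (x : ℝ) : ℝ :=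
  c.layerOutput L (Nat.lt_succ_self L) x

end FourierAmplitudes

/-! The hidden layers turn the jump of `f` into a gap in the output. Iterating `stepMap` from `sin
x` drives the value to `sign x`, and the last hidden layer adds `sin x` again. The final layer thus
receives approximately `sign x + sin x`, which lies in `(-2, -1)` or `(1, 2)` according to the sign
of `x` and still determines `x`. Hence `f x` is `y + G y` at `y = sign x + sin x` for a single `C^m`
function `G` supported in `(-2, 2)` (`IsPiecewiseCmCl.exists_profile`), and the final layer only has
to approximate `G` by a trigonometric polynomial.

The potential `(1 - y) / y` is at least halved by each iteration (`stepMap_potential`), so with `n =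
L - 1` iterations the sign error is at most `min 1 (2 * 2⁻ⁿ / |x|)`, of `L²` norm `O(2^(-L/2))`.
Since `G` is Lipschitz, this error survives the final layer. Truncating the Fourier series of `G`
costs `O(W^(-m+1/2))` uniformly, by integration by parts and Cauchy–Schwarz (`exists_trig_approx`).
-/

/-! ### Dynamics of the hidden layers: convergence to the sign. -/

/-- The self-map of `[-1, 1]` with unstable fixed point `0` and stable fixed points `±1` which is
iterated by the hidden layers. -/
noncomputable def stepMap (y : ℝ) : ℝ := y + Real.sin (Real.pi * y) / Real.pi

lemma stepMap_neg (y : ℝ) : stepMap (-y) = -stepMap y := by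
  simp only [stepMap, mul_neg, Real.sin_neg]; ring

lemma stepMap_iterate_neg (n : ℕ) (y : ℝ) : stepMap^[n] (-y) = -stepMap^[n] y := by
  induction n generalizing y with
  | zero => rfl
  | succ n ih => rw [Function.iterate_succ_apply, Function.iterate_succ_apply, stepMap_neg, ih]

/-- The cubic Taylor bound for the sine; `5 / 3` bounds `π² / 6`. -/
lemma sub_mul_cube_le_sin_pi_div {t : ℝ} (ht : 0 ≤ t) :
    t - 5 / 3 * t ^ 3 ≤ Real.sin (Real.pi * t) / Real.pi := by
  rcases ht.eq_or_lt with rfl | ht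
  · simp
  have hp := Real.pi_pos
  have hp2 : Real.pi ^ 2 ≤ 10 := by nlinarith [Real.pi_lt_d2, Real.pi_gt_three]
  rw [le_div_iff₀ hp]
  have h := Real.sin_gt_sub_cube (mul_pos hp ht)
  have h3 : 0 < Real.pi * t ^ 3 := by positivity
  nlinarith [mul_le_mul_of_nonneg_left hp2 h3.le]

/-- This is the halving of `(1 - y) / y` under `stepMap` with denominators cleared. The cubic bound
is applied at `y` on the left half of `[0, 1]` and, by symmetry of the sine, at `1 - y` on the right
half. -/
lemma mul_one_sub_le_sin_pi_div {y : ℝ} (h0 : 0 ≤ y) (h1 : y ≤ 1) :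
    y * (1 - y) ≤ Real.sin (Real.pi * y) / Real.pi * (1 + y) := by
  rcases le_total y (1 / 2) with h | h
  · have := mul_le_mul_of_nonneg_right (sub_mul_cube_le_sin_pi_div h0)
      (by linarith : (0 : ℝ) ≤ 1 + y)
    nlinarith [mul_nonneg h0 h0, mul_nonneg (mul_nonneg h0 h0) h0,
      mul_nonneg (mul_nonneg h0 h0) (sub_nonneg.2 h),
      mul_nonneg (mul_nonneg (mul_nonneg h0 h0) h0) (sub_nonneg.2 h)]
  · have e : Real.sin (Real.pi * y) = Real.sin (Real.pi * (1 - y)) := by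
      rw [← Real.sin_pi_sub]; congr 1; ring
    rw [e]
    have ht : 0 ≤ 1 - y := by linarith
    have ht2 : 1 - y ≤ 1 / 2 := by linarith
    have hc := sub_mul_cube_le_sin_pi_div ht
    have hsq : (1 - y) ^ 2 ≤ 1 / 4 := by nlinarith
    have hh : (1 - y) / 2 ≤ (1 - y) - 5 / 3 * (1 - y) ^ 3 := by
      nlinarith [mul_le_mul_of_nonneg_left hsq ht]
    have := mul_le_mul_of_nonneg_right (hh.trans hc) (by linarith : (0 : ℝ) ≤ 1 + y)
    nlinarith [mul_nonneg ht ht]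

lemma stepMap_mem {y : ℝ} (h0 : 0 < y) (h1 : y ≤ 1) : 0 < stepMap y ∧ stepMap y ≤ 1 := by
  have hp := Real.pi_pos
  constructor
  · have : 0 ≤ Real.sin (Real.pi * y) :=
      Real.sin_nonneg_of_nonneg_of_le_pi (by positivity) (by nlinarith)
    have := div_nonneg this hp.le
    simp only [stepMap]; linarith
  · have e : Real.sin (Real.pi * y) = Real.sin (Real.pi * (1 - y)) := by
      rw [← Real.sin_pi_sub]; congr 1; ring
    have h := Real.sin_le (mul_nonneg hp.le (sub_nonneg.2 h1))
    have : Real.sin (Real.pi * y) / Real.pi ≤ 1 - y := by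
      rw [div_le_iff₀ hp, e]; linarith
    simp only [stepMap]; linarith

lemma stepMap_potential {y : ℝ} (h0 : 0 < y) (h1 : y ≤ 1) :
    (1 - stepMap y) / stepMap y ≤ (1 - y) / y / 2 := by
  have h := stepMap_mem h0 h1
  rw [div_div, div_le_div_iff₀ h.1 (by positivity)]
  have := mul_one_sub_le_sin_pi_div h0.le h1
  simp only [stepMap] at *
  nlinarith

lemma stepMap_iterate (n : ℕ) {u : ℝ} (h0 : 0 < u) (h1 : u ≤ 1) :
    0 < stepMap^[n] u ∧ stepMap^[n] u ≤ 1 ∧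
      (1 - stepMap^[n] u) / stepMap^[n] u ≤ (1 - u) / u / 2 ^ n := by
  induction n with
  | zero => simp [h0, h1]
  | succ n ih =>
    rw [Function.iterate_succ_apply']
    have h := stepMap_mem ih.1 ih.2.1
    refine ⟨h.1, h.2, (stepMap_potential ih.1 ih.2.1).trans ?_⟩
    rw [pow_succ, ← div_div]
    linarith [ih.2.2]

lemma one_sub_stepMap_iterate_le (n : ℕ) {u : ℝ} (h0 : 0 < u) (h1 : u ≤ 1) :
    1 - stepMap^[n] u ≤ 1 / (2 ^ n * u) := by
  obtain ⟨a, b, c⟩ := stepMap_iterate n h0 h1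
  have h2 : 1 - stepMap^[n] u ≤ (1 - stepMap^[n] u) / stepMap^[n] u := by
    rw [le_div_iff₀ a]; nlinarith
  refine h2.trans (c.trans ?_)
  rw [div_div, mul_comm u]
  gcongr; linarith

/-- The part of the last hidden layer's output that approximates `sign x`. -/
noncomputable def approxSign (n : ℕ) (x : ℝ) : ℝ :=
  -- For `n = 0` the only hidden layer is both first and last. It emits `sin x` just once, and that
  -- copy is needed for the position, so nothing remains for the sign.
  if n = 0 then 0 else stepMap^[n] (Real.sin x)

lemma approxSign_neg (n : ℕ) (x : ℝ) : approxSign n (-x) = -approxSign n x := by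
  simp only [approxSign, Real.sin_neg, stepMap_iterate_neg]; split_ifs <;> simp

lemma half_le_sin {x : ℝ} (h0 : 0 < x) (h1 : x < 1) : x / 2 ≤ Real.sin x := by
  have := Real.sin_gt_sub_cube h0
  nlinarith [mul_pos h0 h0, mul_pos h0 (sub_pos.2 h1), mul_pos (mul_pos h0 h0) (sub_pos.2 h1)]

lemma approxSign_bound (n : ℕ) {x : ℝ} (h0 : 0 < x) (h1 : x < 1) :
    0 ≤ approxSign n x ∧ approxSign n x ≤ 1 ∧ 1 - approxSign n x ≤ 2 / 2 ^ n / x := by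
  rcases eq_or_ne n 0 with rfl | hn
  · simp only [approxSign, if_true, pow_zero, le_refl, zero_le_one, true_and]
    rw [le_div_iff₀ h0]; linarith
  · simp only [approxSign, if_neg hn]
    have hs := half_le_sin h0 h1
    have hs0 : 0 < Real.sin x := by linarith
    obtain ⟨a, b, -⟩ := stepMap_iterate n hs0 (Real.sin_le_one x)
    refine ⟨a.le, b, (one_sub_stepMap_iterate_le n hs0 (Real.sin_le_one x)).trans ?_⟩
    rw [div_div, div_le_div_iff₀ (by positivity) (by positivity)]
    have : (0 : ℝ) < 2 ^ n := by positivity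
    nlinarith

/-! ### Size of the sign error in `L²`. -/

/-- Both `e` and `e * (t / A)` are at most `1`, so their squares add up to at most `2`. The majorant
replaces `min 1 (A / t)` by a function with an explicit integral over the line. -/
lemma sq_le_majorant {e A t : ℝ} (hA : 0 < A) (ht : 0 < t) (he : 0 ≤ e) (h1 : e ≤ 1)
    (h2 : e ≤ A / t) : e ^ 2 ≤ 2 * (1 + (t / A) ^ 2)⁻¹ := by
  have h3 : e * (t / A) ≤ 1 := by
    have := mul_le_mul_of_nonneg_right h2 (by positivity : 0 ≤ t / A)
    rwa [div_mul_div_cancel₀ ht.ne', div_self hA.ne'] at this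
  have h4 : 0 ≤ e * (t / A) := by positivity
  rw [← div_eq_mul_inv, le_div_iff₀ (by positivity)]
  nlinarith [mul_le_mul h1 h1 he zero_le_one, mul_le_mul h3 h3 h4 zero_le_one]

lemma abs_approxSign_sub_sign_le (n : ℕ) {x : ℝ} (h0 : x ≠ 0) (h1 : |x| < 1) :
    |approxSign n x - SignType.sign x| ≤ √(2 * (1 + (x / (2 / 2 ^ n)) ^ 2)⁻¹) := by
  wlog hx : 0 < x generalizing x
  · have hx' : 0 < -x := by
      rcases lt_or_gt_of_ne h0 with h | h
      · linarith
      · exact absurd h hx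
    have := this (neg_ne_zero.2 h0) (by rwa [abs_neg]) hx'
    rw [approxSign_neg, Left.sign_neg, neg_div, neg_sq, SignType.coe_neg, ← neg_add', abs_neg] at this
    rwa [sub_eq_add_neg]
  rw [abs_of_pos hx] at h1
  obtain ⟨a, b, c⟩ := approxSign_bound n hx h1
  rw [sign_pos hx, SignType.coe_one, abs_sub_comm, abs_of_nonneg (by linarith)]
  exact Real.le_sqrt_of_sq_le (sq_le_majorant (by positivity) hx (by linarith) (by linarith) c)

lemma eLpNorm_majorant_le {A : ℝ} (hA : 0 < A) (s : Set ℝ) :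
    eLpNorm (fun x => √(2 * (1 + (x / A) ^ 2)⁻¹)) 2 (volume.restrict s)
      ≤ ENNReal.ofReal (√(2 * Real.pi * A)) := by
  refine (eLpNorm_mono_measure _ Measure.restrict_le_self).trans ?_
  rw [eLpNorm_eq_lintegral_rpow_enorm_toReal (by norm_num) (by norm_num)]
  have e : ∀ x : ℝ, ‖√(2 * (1 + (x / A) ^ 2)⁻¹)‖ₑ ^ (2 : ENNReal).toReal
      = ENNReal.ofReal (2 * (1 + (x / A) ^ 2)⁻¹) := by
    intro x
    rw [Real.enorm_of_nonneg (Real.sqrt_nonneg _), ENNReal.toReal_ofNat, ENNReal.rpow_ofNat,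
      ← ENNReal.ofReal_pow (Real.sqrt_nonneg _), Real.sq_sqrt (by positivity)]
  simp_rw [e]
  have hi : Integrable (fun x : ℝ => 2 * (1 + (x / A) ^ 2)⁻¹) :=
    (integrable_inv_one_add_sq.comp_div hA.ne').const_mul 2
  rw [← ofReal_integral_eq_lintegral_ofReal hi (ae_of_all _ fun x => by positivity),
    integral_const_mul, Measure.integral_comp_div (fun x : ℝ => (1 + x ^ 2)⁻¹),
    integral_univ_inv_one_add_sq, abs_of_pos hA, smul_eq_mul, ENNReal.ofReal_rpow_of_nonneg
      (by positivity) (by positivity), Real.sqrt_eq_rpow]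
  apply le_of_eq
  rw [ENNReal.toReal_ofNat, mul_comm A, mul_assoc]

/-! ### Construction of the smooth profile `G`. -/

lemma IsCmCl.deriv {m : ℕ} {a b : ℝ} {f : ℝ → ℝ} (hf : IsCmCl (m + 1) a b f) :
    IsCmCl m a b (deriv f) := by
  refine ⟨?_, fun k hk => ?_⟩
  · have := hf.1
    rw [Nat.cast_add, Nat.cast_one, contDiffOn_succ_iff_deriv_of_isOpen isOpen_Ioo] at this
    exact this.2.2
  · rw [← iteratedDeriv_succ']
    exact hf.2 (k + 1) (by lia)

/-- Functions in `C^m_cl(a, b)` extend to `C^m` functions on the real line. -/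
lemma IsCmCl.exists_extension {m : ℕ} {a b : ℝ} (hab : a < b) {f : ℝ → ℝ} (hf : IsCmCl m a b f) :
    ∃ g : ℝ → ℝ, ContDiff ℝ m g ∧ Set.EqOn g f (Set.Ioo a b) := by
  induction m generalizing f with
  | zero =>
    obtain ⟨⟨α, hα⟩, β, hβ⟩ := hf.2 0 le_rfl
    rw [iteratedDeriv_zero] at hα hβ
    have hc := hf.1.continuousOn
    have := continuousOn_Icc_extendFrom_Ioo hc hα hβ
    refine ⟨Set.IccExtend hab.le (Set.domRestrict (Set.Icc a b) (extendFrom (Set.Ioo a b) f)), ?_, ?_⟩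
    · rw [Nat.cast_zero, contDiff_zero]
      exact this.domRestrict.Icc_extend'
    · intro x hx
      rw [Set.IccExtend_of_mem _ _ (Set.Ioo_subset_Icc_self hx)]
      exact extendFrom_extends hc x hx
  | succ m ih =>
    obtain ⟨h, hh, he⟩ := ih hf.deriv
    -- The extension of `f` is a primitive of the extension of `f'`, normalised at the midpoint of
    -- the interval.
    have hd : ∀ x, HasDerivAt (fun x => f ((a + b) / 2) + ∫ t in ((a + b) / 2)..x, h t) (h x) x :=
      fun x => (hh.continuous.integral_hasStrictDerivAt _ x).hasDerivAt.const_add _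
    refine ⟨fun x => f ((a + b) / 2) + ∫ t in ((a + b) / 2)..x, h t, ?_, ?_⟩
    · rw [Nat.cast_add, Nat.cast_one, contDiff_succ_iff_deriv]
      refine ⟨fun x => (hd x).differentiableAt, by simp, ?_⟩
      rwa [show _root_.deriv (fun x => f ((a + b) / 2) + ∫ t in ((a + b) / 2)..x, h t) = h from
        funext fun x => (hd x).deriv]
    · have hfd : DifferentiableOn ℝ f (Set.Ioo a b) := hf.1.differentiableOn (by simp)
      refine isOpen_Ioo.eqOn_of_deriv_eq isPreconnected_Ioo
        (fun x _ => (hd x).differentiableAt.differentiableWithinAt) hfd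
        (fun x hx => by rw [(hd x).deriv, he hx]) (x := (a + b) / 2)
        ⟨by linarith, by linarith⟩ (by simp)

/-- A `C^m` function supported near `s` that equals `h (arcsin (y - s)) - y` where
`|y - s| ≤ sin 1`. -/
lemma exists_compactly_supported_arcsin {m : ℕ} {h : ℝ → ℝ} (hh : ContDiff ℝ m h) (s : ℝ) :
    ∃ G : ℝ → ℝ, ContDiff ℝ m G ∧ (tsupport G ⊆ Metric.ball s 1) ∧
      ∀ x ∈ Set.Icc (-1 : ℝ) 1, G (s + Real.sin x) = h x - (s + Real.sin x) := by
  have hs1 : Real.sin 1 < 1 := Real.sin_lt one_pos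
  have hs0 : 0 < Real.sin 1 := Real.sin_pos_of_pos_of_lt_pi one_pos (by linarith [Real.pi_gt_three])
  -- The inner radius `sin 1` covers all values `s + sin x` with `|x| ≤ 1`; the outer radius stays
  -- below `1`, where `arcsin` is still smooth.
  let χ : ContDiffBump s := ⟨Real.sin 1, (Real.sin 1 + 1) / 2, hs0, by linarith⟩
  have hsub : tsupport (fun y => χ y * (h (Real.arcsin (y - s)) - y)) ⊆ Metric.ball s 1 := by
    refine (tsupport_mul_subset_left (f := χ)).trans ?_
    rw [χ.tsupport_eq]
    exact Metric.closedBall_subset_ball (by change (Real.sin 1 + 1) / 2 < 1; linarith)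
  refine ⟨_, contDiff_iff_contDiffAt.2 fun y => ?_, hsub, fun x hx => ?_⟩
  · by_cases hy : y ∈ Metric.ball s 1
    · rw [Metric.mem_ball, Real.dist_eq, abs_lt] at hy
      have ha : ContDiffAt ℝ m (fun y => Real.arcsin (y - s)) y :=
        ContDiffAt.comp (g := Real.arcsin) (f := fun y => y - s) y
          (Real.contDiffAt_arcsin (by linarith [hy.1]) (by linarith [hy.2]))
          (contDiffAt_id.sub contDiffAt_const)
      exact χ.contDiff.contDiffAt.mul ((hh.contDiffAt.comp y ha).sub contDiffAt_id)
    · have : y ∉ tsupport (fun y => χ y * (h (Real.arcsin (y - s)) - y)) := fun h => hy (hsub h)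
      exact (contDiffAt_const (c := (0 : ℝ))).congr_of_eventuallyEq
        (notMem_tsupport_iff_eventuallyEq.1 this)
  · have hpi := Real.pi_gt_three
    have hx1 : Real.sin x ≤ Real.sin 1 :=
      Real.sin_le_sin_of_le_of_le_pi_div_two (by linarith [hx.1]) (by linarith) hx.2
    have hx2 : Real.sin (-1) ≤ Real.sin x :=
      Real.sin_le_sin_of_le_of_le_pi_div_two (by linarith) (by linarith [hx.2]) hx.1
    rw [Real.sin_neg] at hx2
    have : χ (s + Real.sin x) = 1 := by
      apply χ.one_of_mem_closedBall
      rw [Metric.mem_closedBall, Real.dist_eq, add_sub_cancel_left, abs_le]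
      exact ⟨hx2, hx1⟩
    simp only [this, one_mul, add_sub_cancel_left]
    rw [Real.arcsin_sin (by linarith [hx.1]) (by linarith [hx.2])]

/-- The two pieces are supported in `(-2, 0)` and `(0, 2)`, so neither disturbs the other. The
summand `sign x + sin x` outside `G` is what the skip connection of the final layer contributes. -/
lemma IsPiecewiseCmCl.exists_profile {m : ℕ} {f : ℝ → ℝ} (hf : IsPiecewiseCmCl m f) :
    ∃ G : ℝ → ℝ, ContDiff ℝ m G ∧ tsupport G ⊆ Set.Ioo (-2) 2 ∧
      ∀ x ∈ Set.Ioo (-1 : ℝ) 1, x ≠ 0 →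
        (SignType.sign x + Real.sin x) + G (SignType.sign x + Real.sin x) = f x := by
  obtain ⟨h₁, hc₁, he₁⟩ := hf.1.exists_extension (by norm_num)
  obtain ⟨h₂, hc₂, he₂⟩ := hf.2.exists_extension (by norm_num)
  obtain ⟨G₁, hG₁, hs₁, hv₁⟩ := exists_compactly_supported_arcsin hc₁ (-1)
  obtain ⟨G₂, hG₂, hs₂, hv₂⟩ := exists_compactly_supported_arcsin hc₂ 1
  rw [Real.ball_eq_Ioo] at hs₁ hs₂
  refine ⟨fun y => G₁ y + G₂ y, hG₁.add hG₂, (tsupport_add G₁ G₂).trans (Set.union_subset ?_ ?_), ?_⟩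
  · exact hs₁.trans (Set.Ioo_subset_Ioo (by norm_num) (by norm_num))
  · exact hs₂.trans (Set.Ioo_subset_Ioo (by norm_num) (by norm_num))
  have hpi := Real.pi_gt_three
  intro x hx h0
  rcases lt_or_gt_of_ne h0 with h | h
  · have hsin : Real.sin x < 0 := Real.sin_neg_of_neg_of_neg_pi_lt h (by linarith [hx.1])
    have : G₂ (-1 + Real.sin x) = 0 := image_eq_zero_of_notMem_tsupport fun hm => by
      have := (hs₂ hm).1; linarith
    simp only [sign_neg h, SignType.coe_neg, SignType.coe_one, this, hv₁ x (Set.Ioo_subset_Icc_self hx)]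
    rw [he₁ ⟨hx.1, h⟩]; ring
  · have hsin : 0 < Real.sin x := Real.sin_pos_of_pos_of_lt_pi h (by linarith [hx.2])
    have : G₁ (1 + Real.sin x) = 0 := image_eq_zero_of_notMem_tsupport fun hm => by
      have := (hs₁ hm).2; linarith
    simp only [sign_pos h, SignType.coe_one, this, hv₂ x (Set.Ioo_subset_Icc_self hx)]
    rw [he₂ ⟨h, hx.2⟩]; ring

/-! ### Fourier coefficients and truncation error. -/

/-- Integration by parts `m` times, without boundary terms by the support condition; `h` is a
multiple of the `m`-th derivative. Comparing with coefficients of `h`, rather than with a constant,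
keeps the square summability that the rate `-m + 1/2` requires. -/
lemma fourierCoeffOn_norm_mul_le {a b : ℝ} (hab : a < b) (m : ℕ) {g : ℝ → ℂ}
    (hg : ContDiff ℝ m g) (hs : tsupport g ⊆ Set.Ioo a b) :
    ∃ h : ℝ → ℂ, Continuous h ∧
      ∀ k : ℤ, |(k : ℝ)| ^ m * ‖fourierCoeffOn hab g k‖ ≤ ‖fourierCoeffOn hab h k‖ := by
  induction m generalizing g with
  | zero => exact ⟨g, hg.continuous, fun k => by simp⟩
  | succ m ih =>
    rw [Nat.cast_add, Nat.cast_one, contDiff_succ_iff_deriv] at hg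
    obtain ⟨h, hh, hb⟩ := ih hg.2.2
      ((closure_minimal support_deriv_subset (isClosed_tsupport g)).trans hs)
    refine ⟨((b - a) / (2 * Real.pi) : ℝ) • h, hh.const_smul _, fun k => ?_⟩
    have hp := Real.pi_pos
    have hba : 0 < b - a := sub_pos.2 hab
    rcases eq_or_ne k 0 with rfl | hk
    · simp
    have hza : g a = 0 := image_eq_zero_of_notMem_tsupport fun h => (hs h).1.false
    have hzb : g b = 0 := image_eq_zero_of_notMem_tsupport fun h => (hs h).2.false
    have e := fourierCoeffOn_of_hasDerivAt hab hk (f := g) (f' := deriv g)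
      (fun x _ => (hg.1 x).hasDerivAt) (hg.2.2.continuous.intervalIntegrable _ _)
    have hn : ‖fourierCoeffOn hab g k‖
        = (b - a) / (2 * Real.pi) / |(k : ℝ)| * ‖fourierCoeffOn hab (deriv g) k‖ := by
      rw [e, hza, hzb, sub_zero, mul_zero, zero_sub, norm_mul, norm_neg, norm_mul, norm_div,
        ← Complex.ofReal_sub, Complex.norm_of_nonneg hba.le]
      simp only [norm_one, norm_mul, norm_neg, Complex.norm_I, Complex.norm_ofNat,
        Complex.norm_real, Complex.norm_intCast, Real.norm_eq_abs, abs_of_pos hp]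
      field_simp
    have hc : fourierCoeffOn hab (((b - a) / (2 * Real.pi) : ℝ) • h) k
        = (((b - a) / (2 * Real.pi) : ℝ) : ℂ) * fourierCoeffOn hab h k := by
      rw [← fourierCoeffOn.const_mul]; rfl
    have hk' : 0 < |(k : ℝ)| := abs_pos.2 (Int.cast_ne_zero.2 hk)
    rw [hc, hn, norm_mul, Complex.norm_of_nonneg (by positivity)]
    calc _ = (b - a) / (2 * Real.pi) * (|(k : ℝ)| ^ m * ‖fourierCoeffOn hab (deriv g) k‖) := by
          field_simp
          ring
      _ ≤ _ := by gcongr; exact hb k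

lemma summable_sq_fourierCoeffOn {a b : ℝ} (hab : a < b) {h : ℝ → ℂ} (hh : Continuous h) :
    Summable fun k : ℤ => ‖fourierCoeffOn hab h k‖ ^ 2 := by
  refine (hasSum_sq_fourierCoeffOn hab ?_).summable
  obtain ⟨C, hC⟩ := isCompact_Icc.exists_bound_of_continuousOn (hh.continuousOn (s := Set.Icc a b))
  exact MemLp.of_bound hh.aestronglyMeasurable C
    ((ae_restrict_iff' measurableSet_Ioc).2 (ae_of_all _ fun x hx => hC x (Set.Ioc_subset_Icc_self hx)))

/-- For `k ≠ 0`, `u k ≤ d k / |k|`, which is bounded by a sum of two summable squares. -/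
lemma summable_of_pow_mul_le {m : ℕ} (hm : 1 ≤ m) {u d : ℤ → ℝ} (hu : ∀ k, 0 ≤ u k)
    (hd : Summable fun k => d k ^ 2) (h : ∀ k : ℤ, |(k : ℝ)| ^ m * u k ≤ d k) : Summable u := by
  have h2 : Summable fun k : ℤ => 1 / (k : ℝ) ^ 2 := Real.summable_one_div_int_pow.2 one_lt_two
  have h3 : Summable fun k : ℤ => if k = 0 then u 0 else 0 := (hasSum_ite_eq 0 (u 0)).summable
  refine ((hd.add h2).add h3).of_nonneg_of_le hu fun k => ?_
  rcases eq_or_ne k 0 with rfl | hk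
  · simp; positivity
  · have hk1 : 1 ≤ |(k : ℝ)| := by exact_mod_cast Int.one_le_abs hk
    have h4 : |(k : ℝ)| * u k ≤ d k :=
      (mul_le_mul_of_nonneg_right (le_self_pow₀ hk1 (by lia)) (hu k)).trans (h k)
    have h5 : u k ≤ d k * (1 / |(k : ℝ)|) := by
      rw [mul_one_div, le_div_iff₀ (by linarith)]; linarith
    have h6 : (1 / |(k : ℝ)|) ^ 2 = 1 / (k : ℝ) ^ 2 := by rw [div_pow, sq_abs, one_pow]
    simp only [if_neg hk, add_zero]
    nlinarith [sq_nonneg (d k - 1 / |(k : ℝ)|), sq_nonneg (d k), sq_nonneg (1 / |(k : ℝ)|)]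

/-- Cauchy–Schwarz for `d k` against `k^(-m)`. Using `k^(-m) ≤ N^(-(m-1)) / k` reduces the second
factor to the tail of `∑ 1 / k²`, at most `2 / N`. -/
lemma sum_Ico_le_of_pow_mul {m : ℕ} (hm : 1 ≤ m) {u d : ℕ → ℝ} (hu : ∀ k, 0 ≤ u k)
    (hd : Summable fun k => d k ^ 2) {N : ℕ} (hN : 1 ≤ N)
    (h : ∀ k : ℕ, N ≤ k → (k : ℝ) ^ m * u k ≤ d k) (M : ℕ) :
    ∑ k ∈ Finset.Ico N M, u k ≤ √(2 * ∑' k, d k ^ 2) * (N : ℝ) ^ (-(m : ℝ) + 1 / 2) := by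
  have hN0 : (0 : ℝ) < N := by exact_mod_cast hN
  obtain ⟨n, rfl⟩ : ∃ n, m = n + 1 := ⟨m - 1, by lia⟩
  have h1 : ∀ k ∈ Finset.Ico N M, u k ≤ d k * (((N : ℝ) ^ n)⁻¹ * (k : ℝ)⁻¹) := by
    intro k hk
    have hk1 := (Finset.mem_Ico.1 hk).1
    have hkN : (N : ℝ) ≤ k := by exact_mod_cast hk1
    have hk0 : (0 : ℝ) < k := hN0.trans_le hkN
    rw [← mul_inv, ← div_eq_mul_inv, le_div_iff₀ (by positivity)]
    refine le_trans ?_ (h k hk1)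
    rw [mul_comm, pow_succ]
    gcongr
    exact hu k
  have h2 : ∑ k ∈ Finset.Ico N M, (((N : ℝ) ^ n)⁻¹ * (k : ℝ)⁻¹) ^ 2
      ≤ (((N : ℝ) ^ n)⁻¹) ^ 2 * (2 / N) := by
    simp_rw [mul_pow]
    rw [← Finset.mul_sum]
    gcongr
    have e : Finset.Ico N M = Finset.Ioo (N - 1) M := by
      ext k; simp only [Finset.mem_Ico, Finset.mem_Ioo]; lia
    have := sum_Ioo_inv_sq_le (α := ℝ) (N - 1) M
    rw [Nat.cast_sub hN, Nat.cast_one, sub_add_cancel] at this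
    rw [e]
    simpa only [inv_pow] using this
  have h3 : (((N : ℝ) ^ n)⁻¹) ^ 2 * (2 / N) = 2 * ((N : ℝ) ^ (-((n + 1 : ℕ) : ℝ) + 1 / 2)) ^ 2 := by
    rw [← Real.rpow_natCast (_ ^ (_ + _)) 2, ← Real.rpow_mul hN0.le]
    have : (-((n + 1 : ℕ) : ℝ) + 1 / 2) * ((2 : ℕ) : ℝ) = -((2 * n + 1 : ℕ) : ℝ) := by
      push_cast; ring
    rw [this, Real.rpow_neg hN0.le, Real.rpow_natCast]
    field_simp
    ring
  calc _ ≤ ∑ k ∈ Finset.Ico N M, d k * (((N : ℝ) ^ n)⁻¹ * (k : ℝ)⁻¹) := Finset.sum_le_sum h1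
    _ ≤ √(∑ k ∈ Finset.Ico N M, d k ^ 2)
        * √(∑ k ∈ Finset.Ico N M, (((N : ℝ) ^ n)⁻¹ * (k : ℝ)⁻¹) ^ 2) :=
      Real.sum_mul_le_sqrt_mul_sqrt _ _ _
    _ ≤ √(∑' k, d k ^ 2) * √(2 * ((N : ℝ) ^ (-((n + 1 : ℕ) : ℝ) + 1 / 2)) ^ 2) := by
      rw [← h3]
      gcongr
      exact hd.sum_le_tsum _ fun k _ => sq_nonneg _
    _ = _ := by
      rw [Real.sqrt_mul zero_le_two, Real.sqrt_sq (by positivity), Real.sqrt_mul zero_le_two]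
      ring

/-- The Fourier series of a smooth function vanishing near the end points of `[-π, π)`, in terms
of nonnegative frequencies only. -/
lemma exists_hasSum_re_fourier {m : ℕ} (hm : 1 ≤ m) {g : ℝ → ℝ} (hg : ContDiff ℝ m g)
    (hs : tsupport g ⊆ Set.Ioo (-Real.pi) Real.pi) :
    ∃ (c : ℕ → ℂ) (d : ℕ → ℝ), (Summable fun k => ‖c k‖) ∧ (Summable fun k => d k ^ 2) ∧
      (∀ k : ℕ, 1 ≤ k → (k : ℝ) ^ m * ‖c k‖ ≤ d k) ∧
      ∀ y ∈ Set.Ico (-Real.pi) Real.pi,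
        HasSum (fun k : ℕ => (c k * Complex.exp (Complex.I * ((k : ℝ) : ℂ) * y)).re) (g y) := by
  have hT : Fact (0 < 2 * Real.pi) := ⟨Real.two_pi_pos⟩
  have he : -Real.pi + 2 * Real.pi = Real.pi := by ring
  have hab : -Real.pi < -Real.pi + 2 * Real.pi := lt_add_of_pos_right _ hT.out
  set G : ℝ → ℂ := fun x => (g x : ℂ) with hG
  have hGc : ContDiff ℝ m G := Complex.ofRealCLM.contDiff.comp hg
  have hGs : tsupport G ⊆ Set.Ioo (-Real.pi) (-Real.pi + 2 * Real.pi) := by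
    rw [he]; exact (tsupport_comp_subset Complex.ofReal_zero g).trans hs
  obtain ⟨h, hh, hb⟩ := fourierCoeffOn_norm_mul_le hab m hGc hGs
  have hsq := summable_sq_fourierCoeffOn hab hh
  have hsum := summable_of_pow_mul_le hm (fun k => norm_nonneg _) hsq hb
  set a : ℤ → ℂ := fourierCoeffOn hab G with ha
  set b : ℤ → ℂ := fourierCoeffOn hab h with hb'
  have hgz : G (-Real.pi) = G (-Real.pi + 2 * Real.pi) := by
    rw [image_eq_zero_of_notMem_tsupport fun h => (hGs h).1.false,
      image_eq_zero_of_notMem_tsupport fun h => (hGs h).2.false]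
  let F : C(AddCircle (2 * Real.pi), ℂ) :=
    ⟨AddCircle.liftIco (2 * Real.pi) (-Real.pi) G,
      AddCircle.liftIco_continuous hgz hGc.continuous.continuousOn⟩
  have hF : ∀ k, fourierCoeff F k = a k := fun k => fourierCoeff_liftIco_eq G k
  have hFs : Summable (fourierCoeff F) := by
    rw [show fourierCoeff F = a from funext hF]; exact hsum.of_norm
  have inj : Function.Injective (fun n : ℕ => (n : ℤ)) := Nat.cast_injective
  have injneg : Function.Injective (fun n : ℕ => -(n : ℤ)) := fun x y h => by simpa using h
  -- Under the real part, the mode `-k` equals the mode `k` with conjugated coefficient. Pairing `k`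
  -- with `-k` counts the zero mode twice, hence the correction at `k = 0`.
  refine ⟨fun k => a k + (starRingEnd ℂ) (a (-k)) - if k = 0 then (starRingEnd ℂ) (a 0) else 0,
    fun k => ‖b k‖ + ‖b (-k)‖, ?_, ?_, ?_, ?_⟩
  · have h1 : Summable fun k : ℕ => ‖a k‖ + ‖a (-k)‖ + if k = 0 then ‖a 0‖ else 0 :=
      ((hsum.comp_injective inj).add (hsum.comp_injective injneg)).add
        (hasSum_ite_eq 0 ‖a 0‖).summable
    refine h1.of_nonneg_of_le (fun k => norm_nonneg _) fun k => ?_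
    refine (norm_sub_le _ _).trans (add_le_add ((norm_add_le _ _).trans ?_) ?_)
    · rw [RCLike.norm_conj]
    · split_ifs <;> simp
  · have h1 : Summable fun k : ℕ => 2 * (‖b k‖ ^ 2 + ‖b (-k)‖ ^ 2) :=
      ((hsq.comp_injective inj).add (hsq.comp_injective injneg)).mul_left 2
    exact h1.of_nonneg_of_le (fun k => sq_nonneg _) fun k => add_sq_le
  · intro k hk
    simp only [if_neg (by lia : k ≠ 0), sub_zero]
    have h1 := hb k
    have h2 := hb (-k)
    rw [Int.cast_neg, abs_neg] at h2
    rw [Int.cast_natCast, Nat.abs_cast] at h1 h2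
    have h3 : ‖a k + (starRingEnd ℂ) (a (-k))‖ ≤ ‖a k‖ + ‖a (-k)‖ :=
      (norm_add_le _ _).trans (by rw [RCLike.norm_conj])
    have := mul_le_mul_of_nonneg_left h3 (by positivity : (0 : ℝ) ≤ (k : ℝ) ^ m)
    linarith
  · intro y hy
    have h1 := has_pointwise_sum_fourier_series_of_summable hFs (y : AddCircle (2 * Real.pi))
    have h2 : F (y : AddCircle (2 * Real.pi)) = G y :=
      AddCircle.liftIco_coe_apply (f := G) (by rwa [he])
    rw [h2] at h1
    have hexp : ∀ k : ℤ, fourierCoeff F k • fourier k (y : AddCircle (2 * Real.pi))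
        = a k * Complex.exp (Complex.I * ((k : ℝ) : ℂ) * y) := by
      intro k
      rw [hF, smul_eq_mul, fourier_coe_apply]
      congr 2
      have : (Real.pi : ℂ) ≠ 0 := Complex.ofReal_ne_zero.2 Real.pi_ne_zero
      push_cast
      field_simp
    simp_rw [hexp] at h1
    have h3 := (h1.nat_add_neg).sub (hasSum_ite_eq 0 (a 0))
    have h4 := Complex.hasSum_re h3
    simp only [Int.cast_zero, Complex.ofReal_zero, mul_zero, zero_mul, Complex.exp_zero, mul_one,
      add_sub_cancel_right] at h4
    rw [show (G y).re = g y from Complex.ofReal_re _] at h4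
    refine h4.congr_fun fun k => ?_
    have hconj : (a (-k) * Complex.exp (Complex.I * (((-k : ℤ) : ℝ) : ℂ) * y)).re
        = ((starRingEnd ℂ) (a (-k)) * Complex.exp (Complex.I * ((k : ℝ) : ℂ) * y)).re := by
      rw [← Complex.conj_re, map_mul, ← Complex.exp_conj]
      simp
    rw [sub_mul, add_mul, Complex.sub_re, Complex.add_re, Complex.sub_re, Complex.add_re, hconj]
    rcases eq_or_ne k 0 with rfl | hk
    · simp
    · simp [hk]

/-- One coefficient sequence serves every `N`, so its `ℓ¹` norm is an amplitude bound independent of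
the width. -/
lemma exists_trig_approx {m : ℕ} (hm : 1 ≤ m) {g : ℝ → ℝ} (hg : ContDiff ℝ m g)
    (hs : tsupport g ⊆ Set.Ioo (-Real.pi) Real.pi) :
    ∃ (c : ℕ → ℂ) (A D : ℝ), 0 ≤ A ∧ (∀ k, ‖c k‖ ≤ D) ∧
      ∀ N : ℕ, 1 ≤ N → ∀ y ∈ Set.Ico (-Real.pi) Real.pi,
        |g y - (∑ k ∈ Finset.range N, c k * Complex.exp (Complex.I * ((k : ℝ) : ℂ) * y)).re|
          ≤ A * (N : ℝ) ^ (-(m : ℝ) + 1 / 2) := by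
  obtain ⟨c, d, hc, hd, hcd, hsum⟩ := exists_hasSum_re_fourier hm hg hs
  refine ⟨c, √(2 * ∑' k, d k ^ 2), ∑' k, ‖c k‖, Real.sqrt_nonneg _,
    fun k => hc.le_tsum k fun _ _ => norm_nonneg _, fun N hN y hy => ?_⟩
  rw [Complex.re_sum]
  have ht := ((hsum y hy).tendsto_sum_nat.sub_const
    (∑ k ∈ Finset.range N, (c k * Complex.exp (Complex.I * ((k : ℝ) : ℂ) * y)).re)).abs
  refine le_of_tendsto ht ((eventually_ge_atTop N).mono fun M hM => ?_)
  rw [← Finset.sum_Ico_eq_sub _ hM]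
  refine (Finset.abs_sum_le_sum_abs _ _).trans (le_trans (Finset.sum_le_sum fun k _ => ?_)
    (sum_Ico_le_of_pow_mul hm (fun k => norm_nonneg (c k)) hd hN (fun k hk => hcd k (hN.trans hk)) M))
  refine (Complex.abs_re_le_norm _).trans_eq ?_
  rw [norm_mul, mul_assoc, mul_comm Complex.I, ← Complex.ofReal_mul,
    Complex.norm_exp_ofReal_mul_I, mul_one]

/-! ### Realization by a network. -/

lemma fourierBranch_zero (n : ℕ) (ω : Fin n → ℝ) (y : ℝ) :
    fourierBranch (fun _ => 0) ω y = 0 := by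
  simp [fourierBranch]

lemma fourierBranch_of_eq_zero {n : ℕ} (h : n = 0) (c : Fin n → ℂ) (ω : Fin n → ℝ) (y : ℝ) :
    fourierBranch c ω y = 0 := by
  subst h; simp [fourierBranch]

/-- The width enters as `n = 1`, not as `Fin 1`, because the widths in `signNetwork` are conditional
expressions. -/
lemma fourierBranch_sine {n : ℕ} (h : n = 1) (a w y : ℝ) :
    fourierBranch (n := n) (fun _ => -Complex.I * (a : ℂ)) (fun _ => w) y = a * Real.sin (w * y) := by
  subst h
  have : Complex.I * (w : ℂ) * (y : ℂ) = ((w * y : ℝ) : ℂ) * Complex.I := by push_cast; ring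
  rw [fourierBranch, Fin.sum_univ_one, this, Complex.exp_mul_I, ← Complex.ofReal_sin,
    ← Complex.ofReal_cos]
  simp [-Complex.ofReal_mul, -Complex.ofReal_sin, -Complex.ofReal_cos]

lemma fourierBranch_nat {n : ℕ} (c : ℕ → ℂ) (y : ℝ) :
    fourierBranch (n := n) (fun k => c k) (fun k => ((k : ℕ) : ℝ)) y
      = (∑ k ∈ Finset.range n, c k * Complex.exp (Complex.I * ((k : ℝ) : ℂ) * y)).re := by
  rw [fourierBranch, Fin.sum_univ_eq_sum_range
    (fun k => c k * Complex.exp (Complex.I * ((k : ℝ) : ℂ) * y))]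

/-- Frequencies of a network whose hidden layers compute `approxSign L x + sin x` and whose final
layer is a trigonometric polynomial with `N` frequencies. -/
noncomputable def signNetwork (L N : ℕ) : FourierFrequencies L where
  upperWidth ℓ := if ℓ = Fin.last L then 0 else 1
  lowerWidth ℓ := if ℓ = 0 then 0 else if ℓ = Fin.last L then N else 1
  lowerWidth_first := if_pos rfl
  upper _ _ := 1
  lower ℓ k := if ℓ = Fin.last L then ((k : ℕ) : ℝ) else Real.pi

/-- The amplitudes accompanying `signNetwork`; `c` are the amplitudes of the final layer. -/
noncomputable def signAmplitudes (L N : ℕ) (c : ℕ → ℂ) : FourierAmplitudes (signNetwork L N) where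
  -- The first layer starts the iteration at `sin x`, and the last hidden layer restores the
  -- position; the upper neurons in between are switched off.
  upper ℓ _ := if (ℓ : ℕ) = 0 ∨ (ℓ : ℕ) + 1 = L then -Complex.I * ((1 : ℝ) : ℂ) else 0
  lower ℓ k := if ℓ = Fin.last L then c k else -Complex.I * ((Real.pi⁻¹ : ℝ) : ℂ)

lemma signNetwork_width_hidden (L N : ℕ) {ℓ : Fin (L + 1)} (h : ℓ ≠ Fin.last L) :
    (signNetwork L N).width ℓ ≤ 2 := by
  simp only [FourierFrequencies.width, signNetwork, if_neg h]
  split_ifs <;> norm_num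

lemma signNetwork_width_last {L : ℕ} (hL : 1 ≤ L) (N : ℕ) :
    (signNetwork L N).width (Fin.last L) = N := by
  have : Fin.last L ≠ 0 := Fin.ne_of_val_ne (by simp; lia)
  simp [FourierFrequencies.width, signNetwork, this]

section
variable {L N : ℕ} {c : ℕ → ℂ}

lemma signAmplitudes_norm_upper (ℓ : Fin (L + 1)) (k) :
    ‖(signAmplitudes L N c).upper ℓ k‖ ≤ 1 := by
  simp only [signAmplitudes]
  split_ifs <;> simp

lemma signAmplitudes_norm_lower {D : ℝ} (hD : ∀ k, ‖c k‖ ≤ D) (ℓ : Fin (L + 1)) (k) :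
    ‖(signAmplitudes L N c).lower ℓ k‖ ≤ max 1 D := by
  simp only [signAmplitudes]
  split_ifs
  · exact (hD _).trans (le_max_right _ _)
  · refine le_trans ?_ (le_max_left _ _)
    rw [norm_mul, norm_neg, Complex.norm_I, one_mul, Complex.norm_of_nonneg (by positivity)]
    exact inv_le_one_of_one_le₀ (by linarith [Real.pi_gt_three])

lemma signAmplitudes_upper_branch {ℓ : ℕ} (h : ℓ < L + 1) (hℓ : ℓ < L) (x : ℝ) :
    fourierBranch ((signAmplitudes L N c).upper ⟨ℓ, h⟩) ((signNetwork L N).upper ⟨ℓ, h⟩) x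
      = if ℓ = 0 ∨ ℓ + 1 = L then Real.sin x else 0 := by
  have hw : (signNetwork L N).upperWidth ⟨ℓ, h⟩ = 1 :=
    if_neg (Fin.ne_of_val_ne (by simpa using hℓ.ne))
  split_ifs with hc
  · have := fourierBranch_sine hw 1 1 x
    rw [one_mul, one_mul] at this
    rw [← this]
    congr 1
    funext k
    exact if_pos hc
  · rw [← fourierBranch_zero _ ((signNetwork L N).upper ⟨ℓ, h⟩) x]
    congr 1
    funext k
    exact if_neg hc

lemma signAmplitudes_lower_branch {ℓ : ℕ} (h : ℓ + 1 < L + 1) (hℓ : ℓ + 1 < L) (y : ℝ) :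
    fourierBranch ((signAmplitudes L N c).lower ⟨ℓ + 1, h⟩)
      ((signNetwork L N).lower ⟨ℓ + 1, h⟩) y = Real.sin (Real.pi * y) / Real.pi := by
  have hl : (⟨ℓ + 1, h⟩ : Fin (L + 1)) ≠ Fin.last L := Fin.ne_of_val_ne (by simpa using hℓ.ne)
  have h0 : (⟨ℓ + 1, h⟩ : Fin (L + 1)) ≠ 0 := Fin.ne_of_val_ne (by simp)
  have hw : (signNetwork L N).lowerWidth ⟨ℓ + 1, h⟩ = 1 := by
    simp only [signNetwork, if_neg hl, if_neg h0]
  have := fourierBranch_sine hw Real.pi⁻¹ Real.pi y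
  rw [inv_mul_eq_div] at this
  rw [← this]
  congr 1 <;> funext k <;> exact if_neg hl

lemma signAmplitudes_layerOutput_of_lt {ℓ : ℕ} (h : ℓ < L + 1) (hℓ : ℓ + 1 < L) (x : ℝ) :
    (signAmplitudes L N c).layerOutput ℓ h x = stepMap^[ℓ] (Real.sin x) := by
  induction ℓ with
  | zero =>
    rw [FourierAmplitudes.layerOutput, signAmplitudes_upper_branch h (by lia)]
    simp
  | succ ℓ ih =>
    rw [FourierAmplitudes.layerOutput, ih (by lia) (by lia),
      signAmplitudes_upper_branch h (by lia), signAmplitudes_lower_branch h (by lia),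
      if_neg (by lia), add_zero, Function.iterate_succ_apply', stepMap]

lemma signAmplitudes_layerOutput_hidden {n : ℕ} (h : n < n + 1 + 1) (x : ℝ) :
    (signAmplitudes (n + 1) N c).layerOutput n h x = approxSign n x + Real.sin x := by
  cases n with
  | zero =>
    rw [FourierAmplitudes.layerOutput, signAmplitudes_upper_branch h (by lia)]
    simp [approxSign]
  | succ n =>
    rw [FourierAmplitudes.layerOutput, signAmplitudes_layerOutput_of_lt (by lia) (by lia),
      signAmplitudes_upper_branch h (by lia), signAmplitudes_lower_branch h (by lia),
      if_pos (by lia), approxSign, if_neg (by lia), Function.iterate_succ_apply', stepMap]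
    ring

lemma signAmplitudes_realize {n : ℕ} (x : ℝ) :
    (signAmplitudes (n + 1) N c).realize x = (approxSign n x + Real.sin x)
      + (∑ k ∈ Finset.range N, c k * Complex.exp (Complex.I * ((k : ℝ) : ℂ)
          * ((approxSign n x + Real.sin x : ℝ) : ℂ))).re := by
  have hl : (⟨n + 1, Nat.lt_succ_self _⟩ : Fin (n + 1 + 1)) = Fin.last (n + 1) := rfl
  have h0 : Fin.last (n + 1) ≠ 0 := Fin.ne_of_val_ne (by simp)
  have hu : (signNetwork (n + 1) N).upperWidth (Fin.last (n + 1)) = 0 := if_pos rfl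
  have hw : (signNetwork (n + 1) N).lowerWidth (Fin.last (n + 1)) = N := by
    simp only [signNetwork, if_neg h0, if_true]
  rw [FourierAmplitudes.realize, FourierAmplitudes.layerOutput, signAmplitudes_layerOutput_hidden,
    fourierBranch_of_eq_zero hu, add_zero]
  congr 1
  have := fourierBranch_nat (n := (signNetwork (n + 1) N).lowerWidth (Fin.last (n + 1))) c
    (approxSign n x + Real.sin x)
  rw [hw] at this
  rw [← this]
  have key : ∀ y, fourierBranch ((signAmplitudes (n + 1) N c).lower (Fin.last (n + 1)))
      ((signNetwork (n + 1) N).lower (Fin.last (n + 1))) y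
      = fourierBranch (n := (signNetwork (n + 1) N).lowerWidth (Fin.last (n + 1)))
        (fun k => c k) (fun k => ((k : ℕ) : ℝ)) y := fun y => by
    congr 1 <;> funext k <;> exact if_pos rfl
  refine (key _).trans ?_
  rw [fourierBranch_nat, fourierBranch_nat, hw]

end

/-! ### Error estimate and conclusion. -/

lemma abs_approxSign_le_one (n : ℕ) {x : ℝ} (h0 : x ≠ 0) (h1 : |x| < 1) : |approxSign n x| ≤ 1 := by
  rcases lt_or_gt_of_ne h0 with h | h
  · have := approxSign_bound n (neg_pos.2 h) (by rwa [abs_of_neg h] at h1)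
    rw [approxSign_neg] at this
    rw [abs_le]; constructor <;> linarith [this.1, this.2.1]
  · have := approxSign_bound n h (by rwa [abs_of_pos h] at h1)
    rw [abs_le]; constructor <;> linarith [this.1, this.2.1]

/-- Error of the network in terms of the error of the approximate sign function. -/
lemma abs_sub_realize_le {f G : ℝ → ℝ} {K : NNReal} (hG : LipschitzWith K G)
    (hf : ∀ x ∈ Set.Ioo (-1 : ℝ) 1, x ≠ 0 →
      (SignType.sign x + Real.sin x) + G (SignType.sign x + Real.sin x) = f x)
    {c : ℕ → ℂ} {N : ℕ} {E : ℝ}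
    (hc : ∀ y ∈ Set.Ico (-Real.pi) Real.pi,
      |G y - (∑ k ∈ Finset.range N, c k * Complex.exp (Complex.I * ((k : ℝ) : ℂ) * y)).re| ≤ E)
    (n : ℕ) {x : ℝ} (hx : x ∈ Set.Ioo (-1 : ℝ) 1) (h0 : x ≠ 0) :
    |f x - (signAmplitudes (n + 1) N c).realize x|
      ≤ (1 + K) * √(2 * (1 + (x / (2 / 2 ^ n)) ^ 2)⁻¹) + E := by
  have hx1 : |x| < 1 := abs_lt.2 hx
  rw [← hf x hx h0, signAmplitudes_realize]
  set s : ℝ := (SignType.sign x : ℝ) + Real.sin x with hs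
  set y : ℝ := approxSign n x + Real.sin x with hy
  have hys : |s - y| ≤ √(2 * (1 + (x / (2 / 2 ^ n)) ^ 2)⁻¹) := by
    refine le_trans (le_of_eq ?_) (abs_approxSign_sub_sign_le n h0 hx1)
    rw [abs_sub_comm, hs, hy, add_sub_add_right_eq_sub]
  -- Here `|y| ≤ 2 < π`, so `y` lies in the period on which the Fourier sum approximates `G`, even
  -- if it falls into the gap `[-1, 1]`.
  have hym : y ∈ Set.Ico (-Real.pi) Real.pi := by
    have h1 := abs_le.1 (abs_approxSign_le_one n h0 hx1)
    have h2 := Real.neg_one_le_sin x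
    have h3 := Real.sin_le_one x
    have := Real.pi_gt_three
    constructor <;> linarith [h1.1, h1.2]
  have hE := hc y hym
  have hL := hG.dist_le_mul s y
  rw [Real.dist_eq, Real.dist_eq] at hL
  set S := (∑ k ∈ Finset.range N, c k * Complex.exp (Complex.I * ((k : ℝ) : ℂ) * y)).re
  calc |s + G s - (y + S)| = |(s - y) + (G s - G y) + (G y - S)| := by congr 1; ring
    _ ≤ |s - y| + |G s - G y| + |G y - S| := abs_add_three _ _ _
    _ ≤ |s - y| + K * |s - y| + E := by gcongr
    _ = (1 + K) * |s - y| + E := by ring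
    _ ≤ _ := by gcongr

lemma eLpNorm_le_of_abs_le {u : ℝ → ℝ} {B E A : ℝ} (hB : 0 ≤ B) (hE : 0 ≤ E) (hA : 0 < A)
    (h : ∀ x ∈ Set.Ioo (-1 : ℝ) 1, x ≠ 0 → |u x| ≤ B * √(2 * (1 + (x / A) ^ 2)⁻¹) + E) :
    eLpNorm u 2 (volume.restrict (Set.Ioo (-1 : ℝ) 1))
      ≤ ENNReal.ofReal (B * √(2 * Real.pi * A) + E * √2) := by
  set μ := volume.restrict (Set.Ioo (-1 : ℝ) 1)
  set v : ℝ → ℝ := fun x => √(2 * (1 + (x / A) ^ 2)⁻¹) with hv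
  have hvc : Continuous v := by
    have : ∀ x : ℝ, 1 + (x / A) ^ 2 ≠ 0 := fun x => by positivity
    fun_prop (disch := assumption)
  have hne : ∀ᵐ x ∂μ, x ≠ 0 := ae_restrict_of_ae (Measure.ae_ne volume 0)
  have h1 : eLpNorm u 2 μ ≤ eLpNorm (B • v + fun _ => E) 2 μ := by
    refine eLpNorm_mono_ae_real ?_
    filter_upwards [ae_restrict_mem measurableSet_Ioo, hne] with x hx h0
    exact h x hx h0
  refine h1.trans ((eLpNorm_add_le (hvc.aestronglyMeasurable.const_smul B)
    aestronglyMeasurable_const one_le_two).trans ?_)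
  rw [ENNReal.ofReal_add (by positivity) (by positivity)]
  gcongr
  · rw [eLpNorm_const_smul, Real.enorm_of_nonneg hB, ENNReal.ofReal_mul hB]
    gcongr
    exact eLpNorm_majorant_le hA _
  · rw [eLpNorm_const' _ (by norm_num) (by norm_num), Real.enorm_of_nonneg hE,
      ENNReal.ofReal_mul hE, Measure.restrict_apply_univ, Real.volume_Ioo,
      ENNReal.ofReal_rpow_of_nonneg (by norm_num) (by norm_num), Real.sqrt_eq_rpow]
    norm_num

theorem mainTheorem3 (m : ℕ) (hm : 1 ≤ m) :
    ∃ Ω : (L : ℕ) → (W : ℕ) → FourierFrequencies L,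
      (∀ L W : ℕ, 1 ≤ L → 1 ≤ W →
        (∀ ℓ : Fin (L + 1), ℓ ≠ Fin.last L → (Ω L W).width ℓ ≤ 2) ∧
        (Ω L W).width (Fin.last L) = W + 4 * (m + 1)) ∧
      ∀ f : ℝ → ℝ, IsPiecewiseCmCl m f →
        ∃ C D : ℝ, 0 < C ∧ 0 < D ∧
          ∀ L W : ℕ, 1 ≤ L → 1 ≤ W →
            ∃ c : FourierAmplitudes (Ω L W),
              eLpNorm (fun x => f x - c.realize x) 2 (volume.restrict (Set.Ioo (-1 : ℝ) 1))
                ≤ ENNReal.ofReal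
                    (C * ((2 : ℝ) ^ (-(L : ℝ) / 2) + (W : ℝ) ^ (-(m : ℝ) + 1 / 2))) ∧
              (∀ ℓ k, ‖c.upper ℓ k‖ ≤ D) ∧
              (∀ ℓ k, ‖c.lower ℓ k‖ ≤ D) := by
  refine ⟨fun L W => signNetwork L (W + 4 * (m + 1)), fun L W hL _ =>
    ⟨fun ℓ => signNetwork_width_hidden _ _, signNetwork_width_last hL _⟩, fun f hf => ?_⟩
  obtain ⟨G, hG, hGs, hGf⟩ := hf.exists_profile
  have hpi := Real.pi_gt_three
  have hcs : HasCompactSupport G :=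
    isCompact_Icc.of_isClosed_subset (isClosed_tsupport G) (hGs.trans Set.Ioo_subset_Icc_self)
  -- The Lipschitz bound needs one continuous derivative, hence `m ≥ 1`.
  obtain ⟨K, hK⟩ := hG.lipschitzWith_of_hasCompactSupport hcs
    (Nat.cast_ne_zero.2 (by lia : m ≠ 0))
  obtain ⟨c, A, D, hA, hD, hc⟩ := exists_trig_approx hm hG
    (hGs.trans (Set.Ioo_subset_Ioo (by linarith) (by linarith)))
  refine ⟨(1 + K) * √(8 * Real.pi) + A * √2, max 1 D, by positivity, by positivity, ?_⟩
  intro L W hL hW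
  obtain ⟨n, rfl⟩ : ∃ n, L = n + 1 := ⟨L - 1, by lia⟩
  refine ⟨signAmplitudes (n + 1) (W + 4 * (m + 1)) c, ?_,
    fun ℓ k => (signAmplitudes_norm_upper ℓ k).trans (le_max_left _ _),
    signAmplitudes_norm_lower hD⟩
  have hW0 : (0 : ℝ) < W := by exact_mod_cast hW
  set q : ℝ := (W : ℝ) ^ (-(m : ℝ) + 1 / 2) with hq
  have hq0 : 0 ≤ q := by positivity
  have hE : ∀ y ∈ Set.Ico (-Real.pi) Real.pi, |G y - (∑ k ∈ Finset.range (W + 4 * (m + 1)),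
      c k * Complex.exp (Complex.I * ((k : ℝ) : ℂ) * y)).re| ≤ A * q := by
    intro y hy
    refine (hc _ (by lia) y hy).trans (mul_le_mul_of_nonneg_left ?_ hA)
    -- The `4 * (m + 1)` extra neurons can only lower the bound, the exponent being negative.
    refine Real.rpow_le_rpow_of_nonpos hW0 (by exact_mod_cast Nat.le_add_right _ _) ?_
    have : (1 : ℝ) ≤ m := by exact_mod_cast hm
    linarith
  refine (eLpNorm_le_of_abs_le (B := 1 + K) (by positivity) (by positivity : 0 ≤ A * q)
    (by positivity) fun x hx h0 => abs_sub_realize_le hK hGf hE n hx h0).trans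
      (ENNReal.ofReal_le_ofReal ?_)
  -- Passing from `n` iterations to `L = n + 1` hidden layers turns `4π / 2ⁿ` into `8π / 2^L`.
  have hp : √(2 * Real.pi * (2 / 2 ^ n)) = √(8 * Real.pi) * (2 : ℝ) ^ (-((n + 1 : ℕ) : ℝ) / 2) := by
    have : (2 : ℝ) ^ (-((n + 1 : ℕ) : ℝ) / 2) = √(1 / 2 ^ (n + 1)) := by
      rw [Real.sqrt_eq_rpow, one_div, ← Real.rpow_natCast, ← Real.rpow_neg zero_le_two,
        ← Real.rpow_mul zero_le_two]
      congr 1; ring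
    rw [this, ← Real.sqrt_mul (by positivity)]
    congr 1
    rw [pow_succ]; field_simp; norm_num
  rw [hp]
  set p : ℝ := (2 : ℝ) ^ (-((n + 1 : ℕ) : ℝ) / 2)
  have hp0 : 0 ≤ p := by positivity
  have h1 : 0 ≤ (1 + (K : ℝ)) * √(8 * Real.pi) * q := by positivity
  have h2 : 0 ≤ A * √2 * p := by positivity
  nlinarith
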